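/- Consider a finite two-player zero-sum extensive form game with chance moves and perfect recall. Let $Z$ be its set of terminal histories, $u_1=-u_2$ the utilities, $\mathcal I_p$ the set of information sets of Player $p$, $\mathcal I=\mathcal I_1\cup\mathcal I_2$, $A(I)$ the set of actions at $I$, $k=\max_{I\in\mathcal I}|A(I)|$ (with $k=0$ if $\mathcal I=\emptyset$), and $l=\max_{y,z\in Z}(u_1(y)-u_1(z))$. For a profile $\sigma=(\sigma_1,\sigma_2)$ of behavior strategies let $u_p^\sigma$ be the expected utility of Player $p$. Let $\pi_p^\sigma(h)$ be the product of Player $p$'s action probabilities on the way to $h$, let $\pi_{-p}^\sigma(h)$ be the product of the probabilities of all other actions (opponent and chance) on the way to $h$, and let $\pi_p^\sigma(z\mid h)$ be the product of Player $p$'s action probabilities between $h$ and $z$. For $I\in\mathcal I_p$ and $a\in A(I)$ the counterfactual value is $$v^\sigma(I)_a=\sum_{h\in I}\ \sum_{z\in Z,\ ha\sqsubseteq z}\pi_{-p}^\sigma(z)\,\pi_p^\sigma(z\mid ha)\,u_p(z).$$ CFR$^+$ with alternating updates, Player 1 first, is defined as follows. For every $I\in\mathcal I$ set $q^0(I)=0$.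 At time $t\ge 0$ the strategies are $\sigma^t(I)_a=q^t(I)_a/\sum_{b\in A(I)}q^t(I)_b$ if some $q^t(I)_b>0$, and $\sigma^t(I)_a=1/|A(I)|$ otherwise. The update is $$q^{t+1}(I)_a=\max\Big(q^t(I)_a+v^t(I)_a-\sum_{b\in A(I)}\sigma^t(I)_b\,v^t(I)_b,\ 0\Big),$$ where $v^t(I)=v^{(\sigma_1^t,\sigma_2^t)}(I)$ for $I\in\mathcal I_1$ and $v^t(I)=v^{(\sigma_1^{t+1},\sigma_2^t)}(I)$ for $I\in\mathcal I_2$. For strategies $\sigma_p^i$ of Player $p$ and weights $w_i\ge 0$ with $\sum_i w_i=1$, the average strategy $\sum_i w_i\sigma_p^i$ is understood, as usual in CFR, as the behavior strategy that realizes the mixture: $$\bar\sigma_p(I)_a=\frac{\sum_i w_i\,\pi_p^{\sigma^i}(I)\,\sigma^i_p(I)_a}{\sum_i w_i\,\pi_p^{\sigma^i}(I)},$$ where $\pi_p^{\sigma^i}(I)$ is the common value of $\pi_p^{\sigma^i}(h)$, $h\in I$, and $\bar\sigma_p(I)_a=\sum_i w_i\sigma_p^i(I)_a$ if the denominator is $0$.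 Then for every $t\ge 1$ the average profile $$\bar\sigma=\Big(\tfrac{2}{t^2+t}\sum_{i=1}^t i\,\sigma^i_1,\ \tfrac{2}{t^2+t}\sum_{i=0}^{t-1}(i+1)\,\sigma^i_2\Big)$$ is a pair of strategies, and its exploitability satisfies $$\max_{\sigma_1^*}u_1^{(\sigma_1^*,\bar\sigma_2)}-u_1^{\bar\sigma}+\max_{\sigma_2^*}u_2^{(\bar\sigma_1,\sigma_2^*)}-u_2^{\bar\sigma}\ \le\ 2\,|\mathcal I|\,l\,\sqrt{k/t}.$$ -/

import Mathlib

namespace EFG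

/-- Data and basic laws of a finite two-player extensive form game.
A history is the list of the actions taken so far, the most recent action first, so the state
`ha` reached from `h` by action `a` is `a :: h`, the initial state is `[]`, and `h ⊑ j` is the
suffix relation `h <:+ j`.  Player 1 is `0 : Fin 2`, Player 2 is `1 : Fin 2`, and chance is `none`.
The functions `actor`, `chance`, `info` matter only at nonterminal states of `H`, and `u` only at
terminal states.  The information sets are the classes of states with the same label `info`. -/
structure Game (α ι : Type*) [Fintype α] [DecidableEq α] [DecidableEq ι] where
  /-- The set of states. -/
  H : Finset (List α)
  root_mem : [] ∈ H
  parent_mem : ∀ (a : α) (h : List α), a :: h ∈ H → h ∈ H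
  /-- Who acts at a nonterminal state. -/
  actor : List α → Option (Fin 2)
  /-- The probabilities of the chance events. -/
  chance : List α → α → ℝ
  chance_simplex : ∀ h ∈ H, (∃ a, a :: h ∈ H) → actor h = none →
    (∀ a, a :: h ∈ H → 0 ≤ chance h a) ∧ ∑ a with a :: h ∈ H, chance h a = 1
  /-- The utility of a terminal state for each player. -/
  u : Fin 2 → List α → ℝ
  /-- The label of the information set of a state at which a player acts. -/
  info : List α → ι
  info_actor : ∀ h ∈ H, ∀ j ∈ H, (∃ a, a :: h ∈ H) → (∃ a, a :: j ∈ H) →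
    actor h ≠ none → actor j ≠ none → info h = info j → actor h = actor j
  info_actions : ∀ h ∈ H, ∀ j ∈ H, (∃ a, a :: h ∈ H) → (∃ a, a :: j ∈ H) →
    actor h ≠ none → actor j ≠ none → info h = info j → ∀ a, a :: h ∈ H ↔ a :: j ∈ H

namespace Game

noncomputable section

variable {α ι : Type*} [Fintype α] [DecidableEq α] [DecidableEq ι] (G : Game α ι)

/-- The terminal states `Z`. -/
def terminals : Finset (List α) := G.H.filter fun h => ∀ a, a :: h ∉ G.H

/-- The nonterminal states at which Player `p` acts. -/
def nodesOf (p : Fin 2) : Finset (List α) :=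
  G.H.filter fun h => (∃ a, a :: h ∈ G.H) ∧ G.actor h = some p

/-- The information sets of Player `p`. -/
def infosetsOf (p : Fin 2) : Finset ι := (G.nodesOf p).image G.info

/-- The information sets of both players. -/
def infosets : Finset ι := G.infosetsOf 0 ∪ G.infosetsOf 1

/-- The states of Player `p` in the information set `I`. -/
def members (p : Fin 2) (I : ι) : Finset (List α) := (G.nodesOf p).filter fun h => G.info h = I

/-- The actions `A(I)`: those available at the states of `I`. -/
def acts (I : ι) : Finset α :=
  Finset.univ.filter fun a => ∃ p : Fin 2, ∃ h ∈ G.members p I, a :: h ∈ G.H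

/-- The largest number of actions at an information set. -/
def maxActions : ℕ := G.infosets.sup fun I => (G.acts I).card

/-- The game is zero-sum. -/
def ZeroSum : Prop := ∀ z ∈ G.terminals, ∑ p, G.u p z = 0

/-- The sequence of Player `p` information sets passed on the way to a state, with the actions
that Player `p` took there, the most recent first. -/
def ownSequence (p : Fin 2) : List α → List (ι × α)
  | [] => []
  | a :: h => if G.actor h = some p then (G.info h, a) :: ownSequence p h else ownSequence p h

/-- Both players have perfect recall. -/
def PerfectRecall : Prop :=
  ∀ p : Fin 2, ∀ h ∈ G.nodesOf p, ∀ j ∈ G.nodesOf p, G.info h = G.info j →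
    G.ownSequence p h = G.ownSequence p j

/-- `s` gives a probability distribution over `A(I)` at each information set `I` of Player `p`.
The values of `s` elsewhere are irrelevant. -/
def IsStrategy (p : Fin 2) (s : ι → α → ℝ) : Prop :=
  ∀ I ∈ G.infosetsOf p, (∀ a ∈ G.acts I, 0 ≤ s I a) ∧ ∑ a ∈ G.acts I, s I a = 1

/-- The probability of action `a` at `h` under the profile `σ` and chance. -/
def actProb (σ : Fin 2 → ι → α → ℝ) (h : List α) (a : α) : ℝ :=
  match G.actor h with
  | none => G.chance h a
  | some p => σ p (G.info h) a

/-- The probability of reaching a state. -/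
def reach (σ : Fin 2 → ι → α → ℝ) : List α → ℝ
  | [] => 1
  | a :: h => reach σ h * G.actProb σ h a

/-- Player `p`'s contribution to the probability of reaching a state, when `p` plays `s`. -/
def reachOwn (p : Fin 2) (s : ι → α → ℝ) : List α → ℝ
  | [] => 1
  | a :: h => reachOwn p s h * if G.actor h = some p then s (G.info h) a else 1

/-- The contribution of all actors but Player `p` (opponent and chance) to the probability of
reaching a state. -/
def reachOther (p : Fin 2) (σ : Fin 2 → ι → α → ℝ) : List α → ℝ
  | [] => 1
  | a :: h => reachOther p σ h * if G.actor h = some p then 1 else G.actProb σ h a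

/-- Player `p`'s contribution to the probability of reaching a state from the state `j`:
the product over the actions taken at or after `j`. -/
def reachOwnFrom (p : Fin 2) (s : ι → α → ℝ) (j : List α) : List α → ℝ
  | [] => 1
  | a :: h =>
    if j <:+ h then
      reachOwnFrom p s j h * if G.actor h = some p then s (G.info h) a else 1
    else 1

/-- The expected utility of a profile for Player `p`. -/
def utility (p : Fin 2) (σ : Fin 2 → ι → α → ℝ) : ℝ :=
  ∑ z ∈ G.terminals, G.reach σ z * G.u p z

/-- The counterfactual value of a state for Player `p`. -/
def cfValue (p : Fin 2) (σ : Fin 2 → ι → α → ℝ) (h : List α) : ℝ :=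
  ∑ z ∈ G.terminals with h <:+ z,
    G.reachOther p σ z * G.reachOwnFrom p (σ p) h z * G.u p z

/-- The counterfactual value of action `a` at the information set `I` of Player `p`. -/
def cfActionValue (p : Fin 2) (σ : Fin 2 → ι → α → ℝ) (I : ι) (a : α) : ℝ :=
  ∑ h ∈ G.members p I, G.cfValue p σ (a :: h)

/-- The maximal expected utility of Player `p` over all strategies of `p`, against the other
component of `σ`.  The supremum is attained, see `bestResponse_isGreatest`. -/
def bestResponse (p : Fin 2) (σ : Fin 2 → ι → α → ℝ) : ℝ :=
  sSup {x | ∃ s, G.IsStrategy p s ∧ G.utility p (Function.update σ p s) = x}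

/-- Exploitability: the total gain of the two players from switching to a best response. -/
def exploitability (σ : Fin 2 → ι → α → ℝ) : ℝ :=
  ∑ p, (G.bestResponse p σ - G.utility p σ)

/-- The regret-matching policy on the action set `A` for the stored values `x`. -/
def regretMatching (A : Finset α) (x : α → ℝ) (a : α) : ℝ :=
  if ∃ b ∈ A, 0 < x b then max (x a) 0 / ∑ b ∈ A, max (x b) 0 else 1 / (A.card : ℝ)

/-- The strategy obtained from stored values by regret-matching at each information set. -/
def rmStrategy (q : ι → α → ℝ) : ι → α → ℝ := fun I => regretMatching (G.acts I) (q I)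

/-- One update of the regret-like values of Player `p`, by the counterfactual values of `σ`. -/
def rmPlusUpdate (p : Fin 2) (σ : Fin 2 → ι → α → ℝ) (q : ι → α → ℝ) : ι → α → ℝ :=
  fun I a => max
    (q I a + G.cfActionValue p σ I a - ∑ b ∈ G.acts I, σ p I b * G.cfActionValue p σ I b) 0

/-- The regret-like values stored at time `t` by CFR⁺ with alternating updates, Player 1 first. -/
def cfrPlusValues : ℕ → Fin 2 → ι → α → ℝ
  | 0 => fun _ _ _ => 0
  | t + 1 =>
    let q := cfrPlusValues t
    let σ₁ := G.rmStrategy (q 0)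
    let σ₂ := G.rmStrategy (q 1)
    let q₁ := G.rmPlusUpdate 0 ![σ₁, σ₂] (q 0)
    let q₂ := G.rmPlusUpdate 1 ![G.rmStrategy q₁, σ₂] (q 1)
    ![q₁, q₂]

/-- The strategy of Player `p` at time `t` in CFR⁺ with alternating updates, Player 1 first. -/
def cfrPlus (p : Fin 2) (t : ℕ) : ι → α → ℝ := G.rmStrategy (G.cfrPlusValues t p)

/-- Player `p`'s contribution to reaching the information set `I`, summed over the states of `I`.
Under perfect recall all states of `I` contribute equally. -/
def reachInfo (p : Fin 2) (s : ι → α → ℝ) (I : ι) : ℝ := ∑ h ∈ G.members p I, G.reachOwn p s h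

/-- The average of the strategies `s i`, `i ∈ T`, of Player `p` with weights `w i` of sum one:
the behavior strategy that realizes the mixture of the `s i`.  At each information set the
strategies are weighted by `w i` times the probability with which `s i` plays to it, and only by
`w i` where no `s i` plays to it. -/
def averageStrategy (p : Fin 2) (T : Finset ℕ) (w : ℕ → ℝ) (s : ℕ → ι → α → ℝ) : ι → α → ℝ :=
  fun I a =>
    if ∑ i ∈ T, w i * G.reachInfo p (s i) I = 0 then ∑ i ∈ T, w i * s i I a
    else (∑ i ∈ T, w i * G.reachInfo p (s i) I * s i I a) / ∑ i ∈ T, w i * G.reachInfo p (s i) I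

/-- The output of CFR⁺ after `t` iterations: the linearly weighted average profile. -/
def cfrPlusAverage (t : ℕ) : Fin 2 → ι → α → ℝ :=
  ![G.averageStrategy 0 (Finset.Icc 1 t) (fun i => 2 / ((t : ℝ) ^ 2 + t) * i) (G.cfrPlus 0),
    G.averageStrategy 1 (Finset.range t) (fun i => 2 / ((t : ℝ) ^ 2 + t) * (i + 1)) (G.cfrPlus 1)]

theorem acts_nonempty {p : Fin 2} {I : ι} (hI : I ∈ G.infosetsOf p) : (G.acts I).Nonempty := by
  obtain ⟨h, hh, rfl⟩ := Finset.mem_image.1 hI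
  obtain ⟨a, ha⟩ := (Finset.mem_filter.1 hh).2.1
  exact ⟨a, Finset.mem_filter.2 ⟨Finset.mem_univ _, p, h, Finset.mem_filter.2 ⟨hh, rfl⟩, ha⟩⟩

theorem continuous_reach (p : Fin 2) (σ : Fin 2 → ι → α → ℝ) (z : List α) :
    Continuous fun s : ι → α → ℝ => G.reach (Function.update σ p s) z := by
  induction z with
  | nil => exact continuous_const
  | cons a h ih =>
    refine ih.mul ?_
    unfold actProb
    cases G.actor h with
    | none => exact continuous_const
    | some r =>
      by_cases hr : r = p
      · subst hr
        simp only [Function.update_self]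
        fun_prop
      · simp only [Function.update_of_ne hr]
        exact continuous_const

theorem reach_congr (p : Fin 2) (σ : Fin 2 → ι → α → ℝ) (s s' : ι → α → ℝ)
    (hs : ∀ I ∈ G.infosetsOf p, ∀ a ∈ G.acts I, s I a = s' I a) (z : List α) (hz : z ∈ G.H) :
    G.reach (Function.update σ p s) z = G.reach (Function.update σ p s') z := by
  induction z with
  | nil => rfl
  | cons a h ih =>
    have hh := G.parent_mem a h hz
    simp only [reach, ih hh]
    congr 1
    unfold actProb
    cases hact : G.actor h with
    | none => rfl
    | some r =>
      by_cases hr : r = p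
      · subst hr
        have hn : h ∈ G.nodesOf r := Finset.mem_filter.2 ⟨hh, ⟨a, hz⟩, hact⟩
        simp only [Function.update_self]
        exact hs _ (Finset.mem_image_of_mem _ hn) a (Finset.mem_filter.2
          ⟨Finset.mem_univ _, r, h, Finset.mem_filter.2 ⟨hn, rfl⟩, hz⟩)
      · simp only [Function.update_of_ne hr]

/-- The supremum that defines `bestResponse` is a maximum. -/
theorem bestResponse_isGreatest (p : Fin 2) (σ : Fin 2 → ι → α → ℝ) :
    IsGreatest {x | ∃ s, G.IsStrategy p s ∧ G.utility p (Function.update σ p s) = x}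
      (G.bestResponse p σ) := by
  let B : Set (ι → α → ℝ) := Set.univ.pi fun _ => Set.univ.pi fun _ => Set.Icc (0 : ℝ) 1
  have hB : IsCompact B := isCompact_univ_pi fun _ => isCompact_univ_pi fun _ => isCompact_Icc
  have hC : IsClosed {s : ι → α → ℝ | G.IsStrategy p s} := by
    simp only [IsStrategy, Set.ofPred_forall, Set.ofPred_and]
    refine isClosed_iInter fun I => isClosed_iInter fun _ => IsClosed.inter ?_ ?_
    · exact isClosed_iInter fun a => isClosed_iInter fun _ =>
        isClosed_le continuous_const (by fun_prop)
    · exact isClosed_eq (by fun_prop) continuous_const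
  have hne : (B ∩ {s | G.IsStrategy p s}).Nonempty := by
    refine ⟨fun I _ => 1 / ((G.acts I).card : ℝ), fun I _ a _ => ⟨by positivity, ?_⟩, fun I hI => ?_⟩
    · rcases Nat.eq_zero_or_pos (G.acts I).card with h0 | h0
      · simp [h0]
      · rw [div_le_one (by exact_mod_cast h0)]
        exact_mod_cast h0
    · refine ⟨fun a _ => by positivity, ?_⟩
      have hc : ((G.acts I).card : ℝ) ≠ 0 := by
        exact_mod_cast (Finset.card_pos.2 (G.acts_nonempty hI)).ne'
      simp [hc]
  have hcont : Continuous fun s : ι → α → ℝ => G.utility p (Function.update σ p s) :=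
    continuous_finsetSum _ fun z _ => (G.continuous_reach p σ z).mul continuous_const
  obtain ⟨m, hm, hmax⟩ := (hB.inter_right hC).exists_isMaxOn hne hcont.continuousOn
  have hgr : IsGreatest {x | ∃ s, G.IsStrategy p s ∧ G.utility p (Function.update σ p s) = x}
      (G.utility p (Function.update σ p m)) := by
    refine ⟨⟨m, hm.2, rfl⟩, ?_⟩
    rintro x ⟨s, hs, rfl⟩
    let s' : ι → α → ℝ := fun I a => if I ∈ G.infosetsOf p ∧ a ∈ G.acts I then s I a else 0
    have hss : ∀ I ∈ G.infosetsOf p, ∀ a ∈ G.acts I, s I a = s' I a := fun I hI a ha => by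
      simp [s', hI, ha]
    have hs' : s' ∈ B ∩ {s | G.IsStrategy p s} := by
      refine ⟨fun I _ a _ => ?_, fun I hI => ⟨fun a ha => ?_, ?_⟩⟩
      · by_cases h : I ∈ G.infosetsOf p ∧ a ∈ G.acts I
        · simp only [s', h, and_self, if_true]
          refine ⟨(hs I h.1).1 a h.2, ?_⟩
          rw [← (hs I h.1).2]
          exact Finset.single_le_sum (hs I h.1).1 h.2
        · simp [s', h]
      · rw [← hss I hI a ha]
        exact (hs I hI).1 a ha
      · rw [← (hs I hI).2]
        exact Finset.sum_congr rfl fun a ha => (hss I hI a ha).symm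
    have hu : G.utility p (Function.update σ p s) = G.utility p (Function.update σ p s') :=
      Finset.sum_congr rfl fun z hz => by
        rw [G.reach_congr p σ s s' hss z (Finset.mem_filter.1 hz).1]
    rw [hu]
    exact hmax hs'
  rwa [bestResponse, hgr.csSup_eq]

/-- Player 1's stored values are updated with the profile `(σ₁ᵗ, σ₂ᵗ)`. -/
theorem cfrPlusValues_succ_zero (t : ℕ) : G.cfrPlusValues (t + 1) 0 =
    G.rmPlusUpdate 0 ![G.cfrPlus 0 t, G.cfrPlus 1 t] (G.cfrPlusValues t 0) := rfl

/-- Player 2's stored values are updated with the profile `(σ₁ᵗ⁺¹, σ₂ᵗ)`. -/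
theorem cfrPlusValues_succ_one (t : ℕ) : G.cfrPlusValues (t + 1) 1 =
    G.rmPlusUpdate 1 ![G.cfrPlus 0 (t + 1), G.cfrPlus 1 t] (G.cfrPlusValues t 1) := rfl

end

end Game

end EFG

namespace EFG

namespace Game

noncomputable section

variable {α ι : Type*} [Fintype α] [DecidableEq α] [DecidableEq ι] (G : Game α ι)

/-! By zero-sum play the utilities of the average profile cancel in the exploitability, which leaves
the two best response values. An average strategy realizes its mixture, and utility is linear in a
player's own reach contributions, so each best response value is the weighted mean of utilities
against the iterates. Both averages give step `i` the weight proportional to `i + 1`, pairing `σ₂ⁱ`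
with `σ₁ⁱ⁺¹`.

Player 1's regret, however, is measured at `(σ₁ⁱ, σ₂ⁱ)` and Player 2's at `(σ₁ⁱ⁺¹, σ₂ⁱ)`. The
weighted regrets therefore add up to the scaled exploitability plus `∑ (i + 1) (u₁(σ₁ⁱ⁺¹, σ₂ⁱ) -
u₁(σ₁ⁱ, σ₂ⁱ))`. These terms are nonnegative because a CFR⁺ update never loses against the strategy
it responds to (`utility_le_utility_update`), so the regrets bound the exploitability
(`exploitability_le`).

Both the regret bound and this monotonicity reduce to single information sets by the performance
difference lemma (`utility_update_sub`): a change of strategy gains a sum of local regrets with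
coefficients in `[0, 1]`. Locally, `q` is orthogonal to the regret vector `r`, so `‖q‖²` grows by at
most `‖r‖² ≤ k l²` per step and `q ≤ l √(k t)`. Since `r i ≤ q (i + 1) - q i`, Abel summation bounds
the linearly weighted regret by `t q t`. Local regrets are at most `l` because, under perfect
recall, opponent and chance reach an information set with total probability at most one. -/

/-! ### Histories, information sets and sums over the game tree -/

theorem mem_of_suffix {j h : List α} (hjh : j <:+ h) (hh : h ∈ G.H) : j ∈ G.H := by
  induction h with
  | nil => rwa [List.suffix_nil.1 hjh]
  | cons a h ih =>
    rcases List.suffix_cons_iff.1 hjh with rfl | h'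
    · exact hh
    · exact ih h' (G.parent_mem a h hh)

theorem exists_cons_suffix {β : Type*} {j h : List β} (hjh : j <:+ h) (hne : h ≠ j) :
    ∃ a, a :: j <:+ h := by
  induction h with
  | nil => exact absurd (List.suffix_nil.1 hjh).symm hne
  | cons b h ih =>
    rcases List.suffix_cons_iff.1 hjh with rfl | h'
    · exact absurd rfl hne
    · by_cases hj : h = j
      · exact ⟨b, by rw [hj]⟩
      · obtain ⟨a, ha⟩ := ih h' hj
        exact ⟨a, ha.trans (List.suffix_cons b h)⟩

theorem mem_acts_iff {p : Fin 2} {h : List α} (hh : h ∈ G.nodesOf p) (a : α) :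
    a ∈ G.acts (G.info h) ↔ a :: h ∈ G.H := by
  constructor
  · intro ha
    obtain ⟨r, j, hj, hja⟩ := (Finset.mem_filter.1 ha).2
    obtain ⟨hjn, hji⟩ := Finset.mem_filter.1 hj
    obtain ⟨hjH, hjc, hjr⟩ := Finset.mem_filter.1 hjn
    obtain ⟨hhH, hhc, hhr⟩ := Finset.mem_filter.1 hh
    exact (G.info_actions j hjH h hhH hjc hhc (by simp [hjr]) (by simp [hhr]) hji a).1 hja
  · intro ha
    exact Finset.mem_filter.2 ⟨Finset.mem_univ _, p, h, Finset.mem_filter.2 ⟨hh, rfl⟩, ha⟩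

theorem filter_cons_mem {p : Fin 2} {h : List α} (hh : h ∈ G.nodesOf p) :
    (Finset.univ.filter fun a => a :: h ∈ G.H) = G.acts (G.info h) := by
  ext a
  simp [G.mem_acts_iff hh a]

theorem mem_infosetsOf {p : Fin 2} {h : List α} (hh : h ∈ G.nodesOf p) :
    G.info h ∈ G.infosetsOf p := Finset.mem_image_of_mem _ hh

theorem mem_nodesOf_of_cons {p : Fin 2} {a : α} {h : List α} (hz : a :: h ∈ G.H)
    (hp : G.actor h = some p) : h ∈ G.nodesOf p :=
  Finset.mem_filter.2 ⟨G.parent_mem a h hz, ⟨a, hz⟩, hp⟩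

theorem disjoint_infosetsOf : Disjoint (G.infosetsOf 0) (G.infosetsOf 1) := by
  rw [Finset.disjoint_left]
  intro I h0 h1
  obtain ⟨h, hh, rfl⟩ := Finset.mem_image.1 h0
  obtain ⟨j, hj, hji⟩ := Finset.mem_image.1 h1
  obtain ⟨hjH, hjc, hjr⟩ := Finset.mem_filter.1 hj
  obtain ⟨hhH, hhc, hhr⟩ := Finset.mem_filter.1 hh
  have := G.info_actor j hjH h hhH hjc hhc (by simp [hjr]) (by simp [hhr]) hji
  simp [hjr, hhr] at this

/-- Induction on a game tree from the leaves to the root. -/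
theorem leaf_induction {P : List α → Prop}
    (step : ∀ h ∈ G.H, (∀ a, a :: h ∈ G.H → P (a :: h)) → P h) : ∀ h ∈ G.H, P h := by
  have key : ∀ n : ℕ, ∀ h ∈ G.H, G.H.sup List.length ≤ h.length + n → P h := by
    intro n
    induction n with
    | zero =>
      intro h hh hn
      refine step h hh fun a ha => absurd (Finset.le_sup (f := List.length) ha) ?_
      simp only [List.length_cons]
      omega
    | succ n ih =>
      intro h hh hn
      refine step h hh fun a ha => ih _ ha ?_
      simp only [List.length_cons]
      omega
  exact fun h hh => key _ h hh (Nat.le_add_left _ _)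

/-- Telescoping along a finite rooted tree of lists. -/
theorem sum_sub_sum_cons (T : Finset (List α)) (hroot : [] ∈ T)
    (hT : ∀ (a : α) (h : List α), a :: h ∈ T → h ∈ T) (f : List α → ℝ) :
    ∑ h ∈ T, (f h - ∑ a with a :: h ∈ T, f (a :: h)) = f [] := by
  -- Each nonroot state of the tree is the child of exactly one state.
  have key : ∑ h ∈ T, ∑ a with a :: h ∈ T, f (a :: h) = ∑ h ∈ T.erase [], f h := by
    rw [Finset.sum_sigma']
    refine Finset.sum_bij (fun x _ => x.2 :: x.1) ?_ ?_ ?_ ?_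
    · rintro ⟨h, a⟩ hx
      simp only [Finset.mem_sigma, Finset.mem_filter, Finset.mem_univ, true_and] at hx
      simp [hx.2]
    · rintro ⟨h, a⟩ - ⟨h', a'⟩ - heq
      simp only [List.cons.injEq] at heq
      obtain ⟨rfl, rfl⟩ := heq
      rfl
    · rintro h hh
      cases h with
      | nil => simp at hh
      | cons a h =>
        have h1 : a :: h ∈ T := (Finset.mem_erase.1 hh).2
        exact ⟨⟨h, a⟩, by simp [h1, hT a h h1], rfl⟩
    · intros
      rfl
  rw [Finset.sum_sub_distrib, key, ← Finset.add_sum_erase T f hroot]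
  ring

/-- A nonnegative weight that does not increase in total from a state to its children has total
at most its value at the root on each antichain of states. -/
theorem sum_antichain_le (w : List α → ℝ) (hw : ∀ h ∈ G.H, 0 ≤ w h)
    (hsub : ∀ h ∈ G.H, ∑ a with a :: h ∈ G.H, w (a :: h) ≤ w h)
    (A : Finset (List α)) (hA : A ⊆ G.H)
    (hanti : ∀ h ∈ A, ∀ j ∈ A, h <:+ j → h = j) : ∑ h ∈ A, w h ≤ w [] := by
  classical
  -- Prune the tree strictly below `A`: the states of `A` become leaves, so each contributes its
  -- full weight to the telescoping sum, and all other terms are nonnegative.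
  let T : Finset (List α) := G.H.filter fun h => ∀ j ∈ A, j <:+ h → j = h
  have hTH : ∀ h ∈ T, h ∈ G.H := fun h hh => (Finset.mem_filter.1 hh).1
  have hroot : [] ∈ T := Finset.mem_filter.2 ⟨G.root_mem, fun j _ hj => List.suffix_nil.1 hj⟩
  have hT : ∀ (a : α) (h : List α), a :: h ∈ T → h ∈ T := by
    intro a h hh
    obtain ⟨h1, h2⟩ := Finset.mem_filter.1 hh
    refine Finset.mem_filter.2 ⟨G.parent_mem a h h1, fun j hj hjh => ?_⟩
    have h3 := h2 j hj (hjh.trans (List.suffix_cons a h))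
    have h4 := hjh.length_le
    rw [h3, List.length_cons] at h4
    omega
  have hAT : A ⊆ T := fun h hh =>
    Finset.mem_filter.2 ⟨hA hh, fun j hj hjh => hanti j hj h hh hjh⟩
  have hle : ∀ h ∈ G.H, ∑ a with a :: h ∈ T, w (a :: h) ≤ ∑ a with a :: h ∈ G.H, w (a :: h) := by
    intro h hh
    refine Finset.sum_le_sum_of_subset_of_nonneg ?_ fun a ha _ => hw _ (Finset.mem_filter.1 ha).2
    intro a ha
    simp only [Finset.mem_filter, Finset.mem_univ, true_and] at ha ⊢
    exact hTH _ ha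
  rw [← sum_sub_sum_cons T hroot hT w]
  refine le_trans (le_of_eq (Finset.sum_congr rfl fun h hh => ?_))
    (Finset.sum_le_sum_of_subset_of_nonneg hAT fun h hh _ => ?_)
  · have : ∑ a with a :: h ∈ T, w (a :: h) = 0 := by
      refine Finset.sum_eq_zero fun a ha => ?_
      have h1 := (Finset.mem_filter.1 (Finset.mem_filter.1 ha).2).2 h hh (List.suffix_cons a h)
      exact absurd (congrArg List.length h1) (by simp)
    rw [this, sub_zero]
  · exact sub_nonneg.2 ((hle h (hTH h hh)).trans (hsub h (hTH h hh)))

/-! ### Continuation values and counterfactual values -/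

/-- The probability of reaching the second state from the first, zero if it does not follow it. -/
def reachBetween (σ : Fin 2 → ι → α → ℝ) (j : List α) : List α → ℝ
  | [] => if j = [] then 1 else 0
  | a :: h => if j = a :: h then 1 else reachBetween σ j h * G.actProb σ h a

theorem reachBetween_self (σ : Fin 2 → ι → α → ℝ) (j : List α) : G.reachBetween σ j j = 1 := by
  cases j <;> simp [reachBetween]

theorem reachBetween_eq_zero (σ : Fin 2 → ι → α → ℝ) {j h : List α} (hjh : ¬ j <:+ h) :
    G.reachBetween σ j h = 0 := by
  induction h with
  | nil =>
    have : j ≠ [] := by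
      rintro rfl
      exact hjh List.suffix_rfl
    simp [reachBetween, this]
  | cons a h ih =>
    rw [List.suffix_cons_iff, not_or] at hjh
    simp [reachBetween, hjh.1, ih hjh.2]

theorem reachBetween_nil (σ : Fin 2 → ι → α → ℝ) (h : List α) :
    G.reachBetween σ [] h = G.reach σ h := by
  induction h with
  | nil => simp [reachBetween, reach]
  | cons a h ih => simp [reachBetween, reach, ih]

theorem not_cons_suffix {β : Type*} (a : β) (h : List β) : ¬ a :: h <:+ h := fun hs => by
  have := hs.length_le
  simp at this

theorem reachBetween_eq_sum (σ : Fin 2 → ι → α → ℝ) {h z : List α} (hz : z ≠ h) :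
    G.reachBetween σ h z = ∑ a, G.actProb σ h a * G.reachBetween σ (a :: h) z := by
  induction z with
  | nil => simp [reachBetween, hz.symm]
  | cons b z ih =>
    rw [reachBetween, if_neg hz.symm]
    by_cases hzh : z = h
    · subst hzh
      rw [reachBetween_self, Finset.sum_eq_single b]
      · simp [reachBetween_self]
      · intro a _ hab
        rw [reachBetween, if_neg (by simpa using hab),
          G.reachBetween_eq_zero σ (not_cons_suffix a z)]
        simp
      · simp
    · rw [ih hzh, Finset.sum_mul]
      refine Finset.sum_congr rfl fun a _ => ?_
      rw [reachBetween, if_neg (by simp [Ne.symm hzh])]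
      ring

/-- After `h` the factors of all actors are present on the left, before `h` only those of the
others; this separates the counterfactual weight of `h` from the continuation. -/
theorem reachOther_mul_reachOwnFrom (p : Fin 2) (σ : Fin 2 → ι → α → ℝ) {h z : List α}
    (hz : h <:+ z) : G.reachOther p σ z * G.reachOwnFrom p (σ p) h z =
      G.reachOther p σ h * G.reachBetween σ h z := by
  induction z with
  | nil =>
    rw [List.suffix_nil.1 hz]
    simp [reachOwnFrom, reachBetween]
  | cons a z ih =>
    by_cases hh : h = a :: z
    · subst hh
      rw [reachBetween_self, reachOwnFrom, if_neg (not_cons_suffix a z)]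
    · have hs : h <:+ z := (List.suffix_cons_iff.1 hz).resolve_left hh
      rw [reachOwnFrom, if_pos hs, reachBetween, if_neg hh, reachOther,
        ← mul_assoc (G.reachOther p σ h), ← ih hs]
      by_cases hp : G.actor z = some p
      · simp only [hp, if_true, actProb]
        ring
      · simp only [hp, if_false]
        ring

/-- The expected utility from a state on. -/
def value (p : Fin 2) (σ : Fin 2 → ι → α → ℝ) (h : List α) : ℝ :=
  ∑ z ∈ G.terminals, G.reachBetween σ h z * G.u p z

theorem utility_eq_value (p : Fin 2) (σ : Fin 2 → ι → α → ℝ) :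
    G.utility p σ = G.value p σ [] := by
  simp only [utility, value, reachBetween_nil]

theorem cfValue_eq (p : Fin 2) (σ : Fin 2 → ι → α → ℝ) (h : List α) :
    G.cfValue p σ h = G.reachOther p σ h * G.value p σ h := by
  rw [cfValue, value, Finset.mul_sum, Finset.sum_filter]
  refine Finset.sum_congr rfl fun z _ => ?_
  split_ifs with hz
  · rw [G.reachOther_mul_reachOwnFrom p σ hz, mul_assoc]
  · rw [G.reachBetween_eq_zero σ hz]
    ring

theorem value_terminal (p : Fin 2) (σ : Fin 2 → ι → α → ℝ) {h : List α} (hh : h ∈ G.H)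
    (ht : ¬ ∃ a, a :: h ∈ G.H) : G.value p σ h = G.u p h := by
  push Not at ht
  rw [value, Finset.sum_eq_single h]
  · rw [reachBetween_self, one_mul]
  · intro z hz hzh
    rw [G.reachBetween_eq_zero σ, zero_mul]
    intro hs
    obtain ⟨a, ha⟩ := exists_cons_suffix hs hzh
    exact ht a (G.mem_of_suffix ha (Finset.mem_filter.1 hz).1)
  · intro hn
    exact absurd (Finset.mem_filter.2 ⟨hh, ht⟩) hn

theorem value_eq_sum (p : Fin 2) (σ : Fin 2 → ι → α → ℝ) {h : List α}
    (ht : ∃ a, a :: h ∈ G.H) : G.value p σ h =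
      ∑ a with a :: h ∈ G.H, G.actProb σ h a * G.value p σ (a :: h) := by
  have h1 : G.value p σ h = ∑ a, G.actProb σ h a * G.value p σ (a :: h) := by
    simp only [value, Finset.mul_sum]
    rw [Finset.sum_comm]
    refine Finset.sum_congr rfl fun z hz => ?_
    rw [G.reachBetween_eq_sum σ, Finset.sum_mul]
    · exact Finset.sum_congr rfl fun a _ => by ring
    · rintro rfl
      obtain ⟨a, ha⟩ := ht
      exact (Finset.mem_filter.1 hz).2 a ha
  rw [h1, Finset.sum_filter]
  refine Finset.sum_congr rfl fun a _ => ?_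
  split_ifs with ha
  · rfl
  · rw [value, Finset.sum_eq_zero, mul_zero]
    intro z hz
    rw [G.reachBetween_eq_zero σ, zero_mul]
    exact fun hs => ha (G.mem_of_suffix hs (Finset.mem_filter.1 hz).1)

theorem actProb_nonneg {σ : Fin 2 → ι → α → ℝ} (hσ : ∀ p, G.IsStrategy p (σ p)) {a : α}
    {h : List α} (ha : a :: h ∈ G.H) : 0 ≤ G.actProb σ h a := by
  unfold actProb
  cases hact : G.actor h with
  | none => exact (G.chance_simplex h (G.parent_mem a h ha) ⟨a, ha⟩ hact).1 a ha
  | some r =>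
    have hn := G.mem_nodesOf_of_cons ha hact
    exact (hσ r _ (G.mem_infosetsOf hn)).1 a ((G.mem_acts_iff hn a).2 ha)

theorem sum_actProb {σ : Fin 2 → ι → α → ℝ} (hσ : ∀ p, G.IsStrategy p (σ p))
    {h : List α} (ht : ∃ a, a :: h ∈ G.H) : ∑ a with a :: h ∈ G.H, G.actProb σ h a = 1 := by
  obtain ⟨a, ha⟩ := ht
  unfold actProb
  cases hact : G.actor h with
  | none => exact (G.chance_simplex h (G.parent_mem a h ha) ⟨a, ha⟩ hact).2
  | some r =>
    have hn := G.mem_nodesOf_of_cons ha hact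
    rw [G.filter_cons_mem hn]
    exact (hσ r _ (G.mem_infosetsOf hn)).2

theorem value_mem_Icc {p : Fin 2} {σ : Fin 2 → ι → α → ℝ} (hσ : ∀ p, G.IsStrategy p (σ p))
    {m M : ℝ} (hu : ∀ z ∈ G.terminals, G.u p z ∈ Set.Icc m M) :
    ∀ h ∈ G.H, G.value p σ h ∈ Set.Icc m M := by
  refine G.leaf_induction fun h hh ih => ?_
  by_cases ht : ∃ a, a :: h ∈ G.H
  · rw [G.value_eq_sum p σ ht]
    have hs := G.sum_actProb hσ ht
    constructor
    · calc m = ∑ a with a :: h ∈ G.H, G.actProb σ h a * m := by rw [← Finset.sum_mul, hs, one_mul]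
        _ ≤ _ := Finset.sum_le_sum fun a ha => mul_le_mul_of_nonneg_left
            (ih a (Finset.mem_filter.1 ha).2).1 (G.actProb_nonneg hσ (Finset.mem_filter.1 ha).2)
    · calc _ ≤ ∑ a with a :: h ∈ G.H, G.actProb σ h a * M :=
            Finset.sum_le_sum fun a ha => mul_le_mul_of_nonneg_left
              (ih a (Finset.mem_filter.1 ha).2).2 (G.actProb_nonneg hσ (Finset.mem_filter.1 ha).2)
        _ = M := by rw [← Finset.sum_mul, hs, one_mul]
  · rw [G.value_terminal p σ hh ht]
    push Not at ht
    exact hu h (Finset.mem_filter.2 ⟨hh, ht⟩)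

/-! ### Factoring reach probabilities by player -/

theorem reach_eq_mul (p : Fin 2) (σ : Fin 2 → ι → α → ℝ) (h : List α) :
    G.reach σ h = G.reachOwn p (σ p) h * G.reachOther p σ h := by
  induction h with
  | nil => simp [reach, reachOwn, reachOther]
  | cons a h ih =>
    rw [reach, reachOwn, reachOther, ih]
    by_cases hp : G.actor h = some p
    · simp only [hp, if_true, actProb]
      ring
    · simp only [hp, if_false]
      ring

theorem actProb_update (p : Fin 2) (σ : Fin 2 → ι → α → ℝ) (s : ι → α → ℝ) {h : List α}
    (hp : G.actor h ≠ some p) (a : α) :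
    G.actProb (Function.update σ p s) h a = G.actProb σ h a := by
  unfold actProb
  cases hact : G.actor h with
  | none => rfl
  | some r =>
    have : r ≠ p := by
      rintro rfl
      exact hp hact
    simp [Function.update_of_ne this]

theorem reachOther_update (p : Fin 2) (σ : Fin 2 → ι → α → ℝ) (s : ι → α → ℝ) (h : List α) :
    G.reachOther p (Function.update σ p s) h = G.reachOther p σ h := by
  induction h with
  | nil => rfl
  | cons a h ih =>
    rw [reachOther, reachOther, ih]
    split_ifs with hp
    · rfl
    · rw [G.actProb_update p σ s hp]

theorem reachOther_nonneg {σ : Fin 2 → ι → α → ℝ} (hσ : ∀ p, G.IsStrategy p (σ p)) (p : Fin 2)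
    {h : List α} (hh : h ∈ G.H) : 0 ≤ G.reachOther p σ h := by
  induction h with
  | nil => simp [reachOther]
  | cons a h ih =>
    rw [reachOther]
    refine mul_nonneg (ih (G.parent_mem a h hh)) ?_
    split_ifs
    · exact zero_le_one
    · exact G.actProb_nonneg hσ hh

theorem reachOwn_eq_prod (p : Fin 2) (s : ι → α → ℝ) (h : List α) :
    G.reachOwn p s h = ((G.ownSequence p h).map fun x => s x.1 x.2).prod := by
  induction h with
  | nil => simp [reachOwn, ownSequence]
  | cons a h ih =>
    rw [reachOwn, ownSequence, ih]
    split_ifs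
    · rw [List.map_cons, List.prod_cons, mul_comm]
    · rw [mul_one]

theorem IsStrategy.le_one {G : Game α ι} {p : Fin 2} {s : ι → α → ℝ} (hs : G.IsStrategy p s)
    {I : ι} (hI : I ∈ G.infosetsOf p) {a : α} (ha : a ∈ G.acts I) : s I a ≤ 1 := by
  rw [← (hs I hI).2]
  exact Finset.single_le_sum (hs I hI).1 ha

theorem reachOwn_mem_Icc {p : Fin 2} {s : ι → α → ℝ} (hs : G.IsStrategy p s) {h : List α}
    (hh : h ∈ G.H) : G.reachOwn p s h ∈ Set.Icc 0 1 := by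
  induction h with
  | nil => simp [reachOwn]
  | cons a h ih =>
    obtain ⟨h0, h1⟩ := ih (G.parent_mem a h hh)
    rw [reachOwn]
    split_ifs with hp
    · have hn := G.mem_nodesOf_of_cons hh hp
      have ha := (G.mem_acts_iff hn a).2 hh
      have hI := G.mem_infosetsOf hn
      have h2 := (hs _ hI).1 a ha
      exact ⟨mul_nonneg h0 h2, mul_le_one₀ h1 h2 (hs.le_one hI ha)⟩
    · simpa using ⟨h0, h1⟩

theorem mem_members {p : Fin 2} {I : ι} {h : List α} :
    h ∈ G.members p I ↔ h ∈ G.nodesOf p ∧ G.info h = I := Finset.mem_filter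

theorem members_nonempty {p : Fin 2} {I : ι} (hI : I ∈ G.infosetsOf p) :
    (G.members p I).Nonempty := by
  obtain ⟨h, hh, rfl⟩ := Finset.mem_image.1 hI
  exact ⟨h, G.mem_members.2 ⟨hh, rfl⟩⟩

theorem members_subset (p : Fin 2) (I : ι) : G.members p I ⊆ G.H := fun _ hh =>
  (Finset.mem_filter.1 (G.mem_members.1 hh).1).1

/-! ### Performance difference lemma -/

/-- The performance difference lemma, state by state. -/
theorem utility_update_sub_eq_sum_nodes (p : Fin 2) (σ : Fin 2 → ι → α → ℝ) (s : ι → α → ℝ) :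
    G.utility p (Function.update σ p s) - G.utility p σ =
      ∑ h ∈ G.nodesOf p, G.reachOwn p s h * ∑ a ∈ G.acts (G.info h),
        (s (G.info h) a - σ p (G.info h) a) * G.cfValue p σ (a :: h) := by
  -- Telescope the gain in continuation value, weighted by reaching with `s`. At nodes of the others
  -- the transitions agree and at terminals the values agree, so only nodes of `p` contribute, where
  -- `(s - σ p)` times the old child values remains.
  have key := sum_sub_sum_cons G.H G.root_mem G.parent_mem fun h => G.reachOwn p s h *
    G.reachOther p σ h * (G.value p (Function.update σ p s) h - G.value p σ h)
  simp only [reachOwn, reachOther, one_mul, ← utility_eq_value] at key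
  rw [← key, nodesOf, Finset.sum_filter]
  refine Finset.sum_congr rfl fun h hh => ?_
  by_cases ht : ∃ a, a :: h ∈ G.H
  · rw [G.value_eq_sum p σ ht, G.value_eq_sum p _ ht]
    by_cases hp : G.actor h = some p
    · have hn : h ∈ G.nodesOf p := Finset.mem_filter.2 ⟨hh, ht, hp⟩
      rw [if_pos ⟨ht, hp⟩, G.filter_cons_mem hn, ← Finset.sum_sub_distrib, Finset.mul_sum,
        ← Finset.sum_sub_distrib, Finset.mul_sum]
      refine Finset.sum_congr rfl fun a _ => ?_
      simp only [cfValue_eq, reachOther, actProb, hp, if_true, Function.update_self]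
      ring
    · rw [if_neg fun hc => hp hc.2, ← Finset.sum_sub_distrib, Finset.mul_sum,
        ← Finset.sum_sub_distrib]
      refine Finset.sum_eq_zero fun a _ => ?_
      simp only [hp, if_false, G.actProb_update p σ s hp]
      ring
  · rw [if_neg fun hc => ht hc.1, G.value_terminal p σ hh ht, G.value_terminal p _ hh ht]
    push Not at ht
    simp [ht]

/-- The performance difference lemma: a strategy that contributes `c I` to reaching each state of
the information set `I` is compared with `σ p` by the counterfactual values of `σ`. -/
theorem utility_update_sub (p : Fin 2) (σ : Fin 2 → ι → α → ℝ) (s : ι → α → ℝ) (c : ι → ℝ)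
    (hc : ∀ h ∈ G.nodesOf p, G.reachOwn p s h = c (G.info h)) :
    G.utility p (Function.update σ p s) - G.utility p σ =
      ∑ I ∈ G.infosetsOf p, c I * ∑ a ∈ G.acts I,
        (s I a - σ p I a) * G.cfActionValue p σ I a := by
  rw [utility_update_sub_eq_sum_nodes, infosetsOf,
    ← Finset.sum_fiberwise_of_maps_to (g := G.info) fun h hh => Finset.mem_image_of_mem _ hh]
  refine Finset.sum_congr rfl fun I _ => ?_
  simp only [cfActionValue, Finset.mul_sum]
  rw [Finset.sum_comm]
  refine Finset.sum_congr rfl fun h hh => ?_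
  obtain ⟨hn, rfl⟩ := Finset.mem_filter.1 hh
  rw [hc h hn]

/-! ### Consequences of perfect recall -/

theorem reachOwn_eq_of_info_eq (hrecall : G.PerfectRecall) {p : Fin 2} (s : ι → α → ℝ)
    {h j : List α} (hh : h ∈ G.nodesOf p) (hj : j ∈ G.nodesOf p) (hi : G.info h = G.info j) :
    G.reachOwn p s h = G.reachOwn p s j := by
  rw [reachOwn_eq_prod, reachOwn_eq_prod, hrecall p h hh j hj hi]

/-- Supplies the coefficients for `utility_update_sub`; perfect recall makes the choice of a state
in the information set immaterial. -/
theorem exists_reachOwn_eq (hrecall : G.PerfectRecall) {p : Fin 2} {s : ι → α → ℝ}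
    (hs : G.IsStrategy p s) : ∃ c : ι → ℝ, (∀ I ∈ G.infosetsOf p, c I ∈ Set.Icc 0 1) ∧
      ∀ h ∈ G.nodesOf p, G.reachOwn p s h = c (G.info h) := by
  classical
  refine ⟨fun I => if hI : I ∈ G.infosetsOf p then
    G.reachOwn p s (G.members_nonempty hI).choose else 0, fun I hI => ?_, fun h hh => ?_⟩
  · simp only [hI, dif_pos]
    exact G.reachOwn_mem_Icc hs (G.members_subset p I (G.members_nonempty hI).choose_spec)
  · have hI := G.mem_infosetsOf hh
    obtain ⟨h1, h2⟩ := G.mem_members.1 (G.members_nonempty hI).choose_spec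
    simp only [hI, dif_pos]
    exact G.reachOwn_eq_of_info_eq hrecall s hh h1 h2.symm

theorem ownSequence_suffix (p : Fin 2) {j h : List α} (hjh : j <:+ h) :
    G.ownSequence p j <:+ G.ownSequence p h := by
  induction h with
  | nil => rw [List.suffix_nil.1 hjh]
  | cons a h ih =>
    rcases List.suffix_cons_iff.1 hjh with rfl | h'
    · exact List.suffix_rfl
    · rw [ownSequence]
      split_ifs
      · exact (ih h').trans (List.suffix_cons _ _)
      · exact ih h'

/-- If `j` lay strictly beyond `h`, its own sequence would also record the move at `h`, and so be
longer than that of `h`. -/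
theorem eq_of_suffix_of_info_eq (hrecall : G.PerfectRecall) {p : Fin 2} {h j : List α}
    (hh : h ∈ G.nodesOf p) (hj : j ∈ G.nodesOf p) (hi : G.info h = G.info j) (hs : h <:+ j) :
    h = j := by
  by_contra hne
  obtain ⟨a, ha⟩ := exists_cons_suffix hs (Ne.symm hne)
  have h1 := (G.ownSequence_suffix p ha).length_le
  rw [ownSequence, if_pos (Finset.mem_filter.1 hh).2.2, hrecall p h hh j hj hi,
    List.length_cons] at h1
  omega

theorem exists_suffix_of_mem_ownSequence {p : Fin 2} {h : List α} (hh : h ∈ G.H) {x : ι × α}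
    (hx : x ∈ G.ownSequence p h) :
    ∃ j ∈ G.nodesOf p, G.info j = x.1 ∧ x.2 :: j <:+ h := by
  induction h with
  | nil => simp [ownSequence] at hx
  | cons a h ih =>
    have tail : x ∈ G.ownSequence p h → ∃ j ∈ G.nodesOf p, G.info j = x.1 ∧ x.2 :: j <:+ a :: h :=
      fun hx => by
        obtain ⟨j, h1, h2, h3⟩ := ih (G.parent_mem a h hh) hx
        exact ⟨j, h1, h2, h3.trans (List.suffix_cons a h)⟩
    rw [ownSequence] at hx
    split_ifs at hx with hp
    · rcases List.mem_cons.1 hx with rfl | hx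
      · exact ⟨h, G.mem_nodesOf_of_cons hh hp, rfl, List.suffix_rfl⟩
      · exact tail hx
    · exact tail hx

/-- On the way to a state, a player passes each information set at most once. -/
theorem snd_eq_of_mem_ownSequence (hrecall : G.PerfectRecall) {p : Fin 2} {h : List α}
    (hh : h ∈ G.H) {I : ι} {a b : α} (ha : (I, a) ∈ G.ownSequence p h)
    (hb : (I, b) ∈ G.ownSequence p h) : a = b := by
  obtain ⟨j, hj, hjI, hja⟩ := G.exists_suffix_of_mem_ownSequence hh ha
  obtain ⟨j', hj', hjI', hjb⟩ := G.exists_suffix_of_mem_ownSequence hh hb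
  have hjj : j = j' := by
    have hs1 := (List.suffix_cons a j).trans hja
    have hs2 := (List.suffix_cons b j').trans hjb
    have hi : G.info j = G.info j' := hjI.trans hjI'.symm
    rcases List.suffix_or_suffix_of_suffix hs1 hs2 with h1 | h1
    · exact G.eq_of_suffix_of_info_eq hrecall hj hj' hi h1
    · exact (G.eq_of_suffix_of_info_eq hrecall hj' hj hi.symm h1).symm
  subst hjj
  -- Two suffixes of the same history with equal length coincide.
  have h1 := (List.suffix_of_suffix_length_le hja hjb (by simp)).eq_of_length (by simp)
  exact (List.cons.inj h1).1

/-- The opponent and chance reach the states of an information set with total probability at most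
one. -/
theorem sum_reachOther_le_one (hrecall : G.PerfectRecall) {σ : Fin 2 → ι → α → ℝ}
    (hσ : ∀ p, G.IsStrategy p (σ p)) (p : Fin 2) (I : ι) :
    ∑ h ∈ G.members p I, G.reachOther p σ h ≤ 1 := by
  classical
  rcases (G.members p I).eq_empty_or_nonempty with hE | ⟨h₀, hh₀⟩
  · rw [hE, Finset.sum_empty]
    exact zero_le_one
  have hh₀H := G.members_subset p I hh₀
  -- Let Player `p` steer towards `h₀`. By perfect recall all states of `I` share its own sequence,
  -- so the own factor is one at each of them. Off that sequence `s` is zero and thus a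
  -- subprobability only, which suffices for the antichain bound.
  let s : ι → α → ℝ := fun J a => if (J, a) ∈ G.ownSequence p h₀ then 1 else 0
  have hs0 : ∀ J a, 0 ≤ s J a := fun J a => by
    simp only [s]
    split_ifs <;> norm_num
  have hown : ∀ h, 0 ≤ G.reachOwn p s h := fun h => by
    rw [reachOwn_eq_prod]
    refine List.prod_nonneg fun x hx => ?_
    obtain ⟨y, _, rfl⟩ := List.mem_map.1 hx
    exact hs0 _ _
  have key := G.sum_antichain_le (fun h => G.reachOwn p s h * G.reachOther p σ h)
    (fun h hh => mul_nonneg (hown h) (G.reachOther_nonneg hσ p hh)) (fun h hh => ?_)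
    (G.members p I) (G.members_subset p I) (fun h hh j hj hhj => ?_)
  · simp only [reachOwn, reachOther, one_mul] at key
    refine le_trans (le_of_eq (Finset.sum_congr rfl fun h hh => ?_)) key
    obtain ⟨h1, h2⟩ := G.mem_members.1 hh
    obtain ⟨h3, h4⟩ := G.mem_members.1 hh₀
    rw [reachOwn_eq_prod, hrecall p h h1 h₀ h3 (h2.trans h4.symm), List.prod_eq_one, one_mul]
    intro x hx
    obtain ⟨y, hy, rfl⟩ := List.mem_map.1 hx
    simp [s, hy]
  · have hnn := mul_nonneg (hown h) (G.reachOther_nonneg hσ p hh)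
    by_cases ht : ∃ a, a :: h ∈ G.H
    · by_cases hp : G.actor h = some p
      · simp only [reachOwn, reachOther, hp, if_true, mul_one]
        have h1 : ∑ a with a :: h ∈ G.H, s (G.info h) a ≤ 1 := by
          simp only [s, Finset.sum_boole]
          have : ((Finset.univ.filter fun a => a :: h ∈ G.H).filter fun a =>
              (G.info h, a) ∈ G.ownSequence p h₀).card ≤ 1 :=
            Finset.card_le_one.2 fun a ha b hb => G.snd_eq_of_mem_ownSequence hrecall hh₀H
              (Finset.mem_filter.1 ha).2 (Finset.mem_filter.1 hb).2
          exact_mod_cast this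
        calc _ = (G.reachOwn p s h * G.reachOther p σ h) *
              ∑ a with a :: h ∈ G.H, s (G.info h) a := by
              rw [Finset.mul_sum]
              exact Finset.sum_congr rfl fun a _ => by ring
          _ ≤ _ := mul_le_of_le_one_right hnn h1
      · simp only [reachOwn, reachOther, hp, if_false, mul_one]
        have h1 := G.sum_actProb hσ ht
        calc _ = (G.reachOwn p s h * G.reachOther p σ h) *
              ∑ a with a :: h ∈ G.H, G.actProb σ h a := by
              rw [Finset.mul_sum]
              exact Finset.sum_congr rfl fun a _ => by ring
          _ ≤ _ := by rw [h1, mul_one]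
    · push Not at ht
      simpa [ht] using hnn
  · obtain ⟨h1, h2⟩ := G.mem_members.1 hh
    obtain ⟨h3, h4⟩ := G.mem_members.1 hj
    exact G.eq_of_suffix_of_info_eq hrecall h1 h3 (h2.trans h4.symm) hhj

theorem cfActionValue_eq (p : Fin 2) (σ : Fin 2 → ι → α → ℝ) (I : ι) (a : α) :
    G.cfActionValue p σ I a =
      ∑ h ∈ G.members p I, G.reachOther p σ h * G.value p σ (a :: h) := by
  refine Finset.sum_congr rfl fun h hh => ?_
  rw [cfValue_eq, reachOther, if_pos (Finset.mem_filter.1 (G.mem_members.1 hh).1).2.2, mul_one]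

/-! ### Local regrets -/

/-- The instantaneous counterfactual regret of `σ p` at `I` for the action `a`. -/
def instRegret (p : Fin 2) (σ : Fin 2 → ι → α → ℝ) (I : ι) (a : α) : ℝ :=
  G.cfActionValue p σ I a - ∑ b ∈ G.acts I, σ p I b * G.cfActionValue p σ I b

/-- The baseline subtracted in the regret does not depend on the action, and `s` has total mass one.
-/
theorem sum_sub_mul_cfActionValue {p : Fin 2} {σ : Fin 2 → ι → α → ℝ} {s : ι → α → ℝ}
    (hs : G.IsStrategy p s) {I : ι} (hI : I ∈ G.infosetsOf p) :
    ∑ a ∈ G.acts I, (s I a - σ p I a) * G.cfActionValue p σ I a =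
      ∑ a ∈ G.acts I, s I a * G.instRegret p σ I a := by
  simp only [instRegret, sub_mul, mul_sub, Finset.sum_sub_distrib]
  rw [← Finset.sum_mul, (hs I hI).2, one_mul]

/-- Every action value, and hence their mean under `σ p`, lies in `[R m, R M]`, where `R ≤ 1` is the
total counterfactual reach of `I`. -/
theorem abs_instRegret_le (hrecall : G.PerfectRecall) {σ : Fin 2 → ι → α → ℝ}
    (hσ : ∀ p, G.IsStrategy p (σ p)) {p : Fin 2} {m M : ℝ}
    (hu : ∀ z ∈ G.terminals, G.u p z ∈ Set.Icc m M) {I : ι} (hI : I ∈ G.infosetsOf p) {a : α}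
    (ha : a ∈ G.acts I) : |G.instRegret p σ I a| ≤ M - m := by
  have hval : ∀ h ∈ G.members p I, ∀ b ∈ G.acts I, G.value p σ (b :: h) ∈ Set.Icc m M := by
    intro h hh b hb
    obtain ⟨hn, rfl⟩ := G.mem_members.1 hh
    exact G.value_mem_Icc hσ hu _ ((G.mem_acts_iff hn b).1 hb)
  have hr : ∀ h ∈ G.members p I, 0 ≤ G.reachOther p σ h := fun h hh =>
    G.reachOther_nonneg hσ p (G.members_subset p I hh)
  set R := ∑ h ∈ G.members p I, G.reachOther p σ h with hR
  have hR0 : 0 ≤ R := Finset.sum_nonneg hr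
  have hR1 : R ≤ 1 := G.sum_reachOther_le_one hrecall hσ p I
  have hv : ∀ b ∈ G.acts I, G.cfActionValue p σ I b ∈ Set.Icc (R * m) (R * M) := by
    intro b hb
    rw [cfActionValue_eq, hR, Finset.sum_mul, Finset.sum_mul]
    exact ⟨Finset.sum_le_sum fun h hh => mul_le_mul_of_nonneg_left (hval h hh b hb).1 (hr h hh),
      Finset.sum_le_sum fun h hh => mul_le_mul_of_nonneg_left (hval h hh b hb).2 (hr h hh)⟩
  obtain ⟨hs0, hs1⟩ := hσ p I hI
  have h1 : R * m ≤ ∑ b ∈ G.acts I, σ p I b * G.cfActionValue p σ I b := by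
    calc R * m = ∑ b ∈ G.acts I, σ p I b * (R * m) := by rw [← Finset.sum_mul, hs1, one_mul]
      _ ≤ _ := Finset.sum_le_sum fun b hb => mul_le_mul_of_nonneg_left (hv b hb).1 (hs0 b hb)
  have h2 : ∑ b ∈ G.acts I, σ p I b * G.cfActionValue p σ I b ≤ R * M := by
    calc _ ≤ ∑ b ∈ G.acts I, σ p I b * (R * M) :=
          Finset.sum_le_sum fun b hb => mul_le_mul_of_nonneg_left (hv b hb).2 (hs0 b hb)
      _ = R * M := by rw [← Finset.sum_mul, hs1, one_mul]
  obtain ⟨h3, h4⟩ := hv a ha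
  have hmM : 0 ≤ M - m := by
    obtain ⟨h, hh⟩ := G.members_nonempty hI
    have := hval h hh a ha
    linarith [this.1, this.2]
  have h5 : R * (M - m) ≤ M - m := mul_le_of_le_one_left hmM hR1
  rw [instRegret, abs_le]
  constructor <;> linarith

/-! ### Regret-matching⁺ on a single action set -/

theorem sum_max_pos_of_exists {β : Type*} {A : Finset β} {x : β → ℝ} (h : ∃ b ∈ A, 0 < x b) :
    0 < ∑ b ∈ A, max (x b) 0 := by
  obtain ⟨b, hb, hx⟩ := h
  exact Finset.sum_pos' (fun _ _ => le_max_right _ _) ⟨b, hb, lt_max_of_lt_left hx⟩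

theorem regretMatching_nonneg {β : Type*} (A : Finset β) (x : β → ℝ) (a : β) :
    0 ≤ regretMatching A x a := by
  unfold regretMatching
  split_ifs with h
  · exact div_nonneg (le_max_right _ _) (sum_max_pos_of_exists h).le
  · positivity

theorem sum_regretMatching {β : Type*} {A : Finset β} (hA : A.Nonempty) (x : β → ℝ) :
    ∑ a ∈ A, regretMatching A x a = 1 := by
  unfold regretMatching
  split_ifs with h
  · rw [← Finset.sum_div, div_self (sum_max_pos_of_exists h).ne']
  · have : (A.card : ℝ) ≠ 0 := by exact_mod_cast hA.card_ne_zero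
    simp [this]

theorem isStrategy_rmStrategy (p : Fin 2) (q : ι → α → ℝ) : G.IsStrategy p (G.rmStrategy q) :=
  fun _ hI => ⟨fun a _ => regretMatching_nonneg _ _ a, sum_regretMatching (G.acts_nonempty hI) _⟩

/-- Nonnegative stored values are orthogonal to the regrets of the regret-matching policy. -/
theorem sum_mul_regret_eq_zero {β : Type*} (A : Finset β) {q : β → ℝ} (hq : ∀ a ∈ A, 0 ≤ q a)
    (v : β → ℝ) :
    ∑ a ∈ A, q a * (v a - ∑ b ∈ A, regretMatching A q b * v b) = 0 := by
  by_cases h : ∃ b ∈ A, 0 < q b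
  · have hS := (sum_max_pos_of_exists h).ne'
    have hmax : ∀ a ∈ A, max (q a) 0 = q a := fun a ha => max_eq_left (hq a ha)
    have h1 : ∀ a ∈ A, regretMatching A q a = q a / ∑ b ∈ A, q b := fun a ha => by
      rw [regretMatching, if_pos h, hmax a ha, Finset.sum_congr rfl hmax]
    rw [Finset.sum_congr rfl hmax] at hS
    have h2 : ∑ b ∈ A, regretMatching A q b * v b = (∑ b ∈ A, q b * v b) / ∑ b ∈ A, q b := by
      rw [Finset.sum_div]
      exact Finset.sum_congr rfl fun b hb => by rw [h1 b hb, div_mul_eq_mul_div]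
    simp only [h2, mul_sub, Finset.sum_sub_distrib]
    rw [← Finset.sum_mul, mul_div_cancel₀ _ hS, sub_self]
  · push Not at h
    exact Finset.sum_eq_zero fun a ha => by rw [le_antisymm (h a ha) (hq a ha), zero_mul]

/-- The potential of regret-matching⁺ grows by at most the squared norm of the regrets. -/
theorem sum_sq_max_add_le {β : Type*} (A : Finset β) {q r : β → ℝ} (hqr : ∑ a ∈ A, q a * r a = 0) :
    ∑ a ∈ A, max (q a + r a) 0 ^ 2 ≤ ∑ a ∈ A, q a ^ 2 + ∑ a ∈ A, r a ^ 2 := by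
  have h1 : ∑ a ∈ A, (q a + r a) ^ 2 = ∑ a ∈ A, q a ^ 2 + ∑ a ∈ A, r a ^ 2 := by
    have : ∀ a ∈ A, (q a + r a) ^ 2 = q a ^ 2 + r a ^ 2 + 2 * (q a * r a) := fun a _ => by ring
    rw [Finset.sum_congr rfl this, Finset.sum_add_distrib, Finset.sum_add_distrib,
      ← Finset.mul_sum, hqr, mul_zero, add_zero]
  rw [← h1]
  refine Finset.sum_le_sum fun a _ => ?_
  rcases max_cases (q a + r a) 0 with ⟨h, _⟩ | ⟨h, _⟩ <;> rw [h]
  nlinarith [sq_nonneg (q a + r a)]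

/-- The policy after a regret-matching⁺ update does not lose against the regrets of the update. -/
theorem sum_regretMatching_update_mul_nonneg {β : Type*} (A : Finset β) {q r : β → ℝ}
    (hq : ∀ a ∈ A, 0 ≤ q a) (hqr : ∑ a ∈ A, q a * r a = 0)
    (hr : ∑ a ∈ A, regretMatching A q a * r a = 0) :
    0 ≤ ∑ a ∈ A, regretMatching A (fun a => max (q a + r a) 0) a * r a := by
  by_cases h : ∃ b ∈ A, 0 < max (q b + r b) 0
  · have hS := sum_max_pos_of_exists h
    have h1 : ∀ a, regretMatching A (fun a => max (q a + r a) 0) a * r a =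
        (max (q a + r a) 0 * r a) / ∑ b ∈ A, max (max (q b + r b) 0) 0 := fun a => by
      rw [regretMatching, if_pos h, max_eq_left (le_max_right (q a + r a) 0)]
      ring
    simp only [h1]
    rw [← Finset.sum_div]
    -- Termwise `max (q + r) 0 * r ≥ q * r`: the stored value moves in the direction of the sign of
    -- `r`, and the right side sums to zero.
    refine div_nonneg (hqr.ge.trans (Finset.sum_le_sum fun a ha => ?_)) hS.le
    rcases le_total 0 (r a) with hra | hra
    · exact mul_le_mul_of_nonneg_right (le_max_of_le_left (by linarith)) hra
    · exact mul_le_mul_of_nonpos_right (max_le (by linarith) (hq a ha)) hra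
  -- If the update clears all values, then `∑ q² ≤ -∑ q r = 0`. So `q` was already zero and the
  -- policy is uniform before and after, with zero regret against itself.
  · have hle : ∀ a ∈ A, q a + r a ≤ 0 := fun a ha => by
      by_contra hlt
      exact h ⟨a, ha, lt_max_of_lt_left (not_le.1 hlt)⟩
    have hsq : ∑ a ∈ A, q a ^ 2 = 0 := by
      refine le_antisymm ?_ (Finset.sum_nonneg fun a _ => sq_nonneg _)
      have : ∑ a ∈ A, q a ^ 2 + ∑ a ∈ A, q a * r a ≤ 0 := by
        rw [← Finset.sum_add_distrib]
        exact Finset.sum_nonpos fun a ha => by nlinarith [hq a ha, hle a ha]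
      linarith
    have hq0 : ∀ a ∈ A, q a = 0 := fun a ha => by
      have := (Finset.sum_eq_zero_iff_of_nonneg fun a _ => sq_nonneg (q a)).1 hsq a ha
      exact pow_eq_zero_iff two_ne_zero |>.1 this
    have hno : ¬ ∃ b ∈ A, 0 < q b := by
      rintro ⟨b, hb, hb'⟩
      exact hb'.ne' (hq0 b hb)
    refine ge_of_eq (Eq.trans ?_ hr)
    simp only [regretMatching, if_neg h, if_neg hno]

/-- Under regret-matching⁺ the linearly weighted cumulative regrets are at most `t` times the
stored values. -/
theorem sum_weighted_regret_le {q r : ℕ → ℝ} (hq : ∀ i, 0 ≤ q i)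
    (hqr : ∀ i, q i + r i ≤ q (i + 1)) (t : ℕ) :
    ∑ i ∈ Finset.range t, ((i : ℝ) + 1) * r i ≤ t * q t := by
  -- Abel summation of `(i + 1) (q (i + 1) - q i)` leaves `t q t - ∑ q i`; keeping the last sum
  -- makes the induction close.
  suffices h : ∑ i ∈ Finset.range t, ((i : ℝ) + 1) * r i + ∑ i ∈ Finset.range t, q i ≤ t * q t by
    linarith [Finset.sum_nonneg fun i (_ : i ∈ Finset.range t) => hq i]
  induction t with
  | zero => simp
  | succ t ih =>
    rw [Finset.sum_range_succ, Finset.sum_range_succ]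
    push_cast
    have := mul_le_mul_of_nonneg_left (hqr t) (by positivity : (0 : ℝ) ≤ t + 1)
    linarith

/-- Regret-matching⁺ with regrets bounded by `L` on a set `A` of at most `k` actions has stored
values at most `L √(k t)` at time `t`. -/
theorem regretMatching_plus_le {β : Type*} (A : Finset β) {q r : ℕ → β → ℝ}
    (h0 : ∀ a ∈ A, q 0 a = 0)
    (hstep : ∀ i, ∀ a ∈ A, q (i + 1) a = max (q i a + r i a) 0)
    (hqr : ∀ i, ∑ a ∈ A, q i a * r i a = 0) {L k : ℝ} (hL : 0 ≤ L) (hk : (A.card : ℝ) ≤ k)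
    (hr : ∀ i, ∀ a ∈ A, |r i a| ≤ L) (t : ℕ) {a : β} (ha : a ∈ A) :
    q t a ≤ L * Real.sqrt (k * t) := by
  -- The squared norm is the potential; a single coordinate is bounded by the whole norm.
  have hsum : ∑ a ∈ A, q t a ^ 2 ≤ t * (k * L ^ 2) := by
    induction t with
    | zero => simp +contextual [h0]
    | succ t ih =>
      rw [Finset.sum_congr rfl fun a ha => by rw [hstep t a ha]]
      refine (sum_sq_max_add_le A (hqr t)).trans ?_
      have h1 : ∑ a ∈ A, r t a ^ 2 ≤ k * L ^ 2 := by
        calc ∑ a ∈ A, r t a ^ 2 ≤ ∑ _a ∈ A, L ^ 2 :=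
              Finset.sum_le_sum fun a ha =>
                sq_le_sq' (abs_le.1 (hr t a ha)).1 (abs_le.1 (hr t a ha)).2
          _ = A.card * L ^ 2 := by rw [Finset.sum_const, nsmul_eq_mul]
          _ ≤ _ := mul_le_mul_of_nonneg_right hk (sq_nonneg L)
      push_cast
      linarith
  have h2 : q t a ^ 2 ≤ t * (k * L ^ 2) :=
    (Finset.single_le_sum (fun a _ => sq_nonneg (q t a)) ha).trans hsum
  refine (Real.le_sqrt_of_sq_le h2).trans (le_of_eq ?_)
  rw [show (t : ℝ) * (k * L ^ 2) = L ^ 2 * (k * t) by ring, Real.sqrt_mul (sq_nonneg L),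
    Real.sqrt_sq hL]

/-! ### Monotonicity and weighted regret of CFR⁺ -/

theorem rmPlusUpdate_eq (p : Fin 2) (σ : Fin 2 → ι → α → ℝ) (q : ι → α → ℝ) (I : ι) (a : α) :
    G.rmPlusUpdate p σ q I a = max (q I a + G.instRegret p σ I a) 0 := by
  rw [rmPlusUpdate, instRegret, add_sub_assoc]

theorem sum_mul_instRegret {p : Fin 2} {σ : Fin 2 → ι → α → ℝ} {q : ι → α → ℝ}
    (hσ : σ p = G.rmStrategy q) (hq : ∀ I a, 0 ≤ q I a) (I : ι) :
    ∑ a ∈ G.acts I, q I a * G.instRegret p σ I a = 0 := by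
  simp only [instRegret, hσ]
  exact sum_mul_regret_eq_zero (G.acts I) (fun a _ => hq I a) _

theorem utility_update_sub_eq (p : Fin 2) (σ : Fin 2 → ι → α → ℝ) {s : ι → α → ℝ}
    (hs : G.IsStrategy p s) (c : ι → ℝ)
    (hc : ∀ h ∈ G.nodesOf p, G.reachOwn p s h = c (G.info h)) :
    G.utility p (Function.update σ p s) - G.utility p σ =
      ∑ I ∈ G.infosetsOf p, c I * ∑ a ∈ G.acts I, s I a * G.instRegret p σ I a := by
  rw [G.utility_update_sub p σ s c hc]
  exact Finset.sum_congr rfl fun I hI => by rw [G.sum_sub_mul_cfActionValue hs hI]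

/-- A CFR⁺ update does not decrease the utility against the strategy it responds to. -/
theorem utility_le_utility_update (hrecall : G.PerfectRecall) {p : Fin 2}
    {σ : Fin 2 → ι → α → ℝ} {q : ι → α → ℝ} (hσ : σ p = G.rmStrategy q)
    (hq : ∀ I a, 0 ≤ q I a) : G.utility p σ ≤
      G.utility p (Function.update σ p (G.rmStrategy (G.rmPlusUpdate p σ q))) := by
  have hs := G.isStrategy_rmStrategy p (G.rmPlusUpdate p σ q)
  obtain ⟨c, hc, hc'⟩ := G.exists_reachOwn_eq hrecall hs
  rw [← sub_nonneg, G.utility_update_sub_eq p σ hs c hc']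
  refine Finset.sum_nonneg fun I hI => mul_nonneg (hc I hI).1 ?_
  -- The current policy has zero regret against itself; this settles the case of a vanishing update.
  have h1 : ∑ a ∈ G.acts I, σ p I a * G.instRegret p σ I a = 0 := by
    have hσp : G.IsStrategy p (σ p) := hσ ▸ G.isStrategy_rmStrategy p q
    rw [← G.sum_sub_mul_cfActionValue hσp hI]
    simp
  have h2 := sum_regretMatching_update_mul_nonneg (G.acts I) (fun a _ => hq I a)
    (G.sum_mul_instRegret hσ hq I) (by rw [hσ] at h1; exact h1)
  simpa only [rmStrategy, ← rmPlusUpdate_eq] using h2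

/-- The linearly weighted regret of a player who plays by CFR⁺ against any opponents. -/
theorem sum_weighted_utility_sub_le (hrecall : G.PerfectRecall) {p : Fin 2}
    {σ : ℕ → Fin 2 → ι → α → ℝ} {q : ℕ → ι → α → ℝ} (hσ : ∀ i r, G.IsStrategy r (σ i r))
    (hσq : ∀ i, σ i p = G.rmStrategy (q i)) (hq0 : ∀ I a, q 0 I a = 0)
    (hstep : ∀ i, q (i + 1) = G.rmPlusUpdate p (σ i) (q i))
    {m M : ℝ} (hmM : m ≤ M) (hu : ∀ z ∈ G.terminals, G.u p z ∈ Set.Icc m M)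
    {k : ℝ} (hk : ∀ I ∈ G.infosetsOf p, ((G.acts I).card : ℝ) ≤ k)
    {s : ι → α → ℝ} (hs : G.IsStrategy p s) (t : ℕ) :
    ∑ i ∈ Finset.range t, ((i : ℝ) + 1) *
        (G.utility p (Function.update (σ i) p s) - G.utility p (σ i)) ≤
      (G.infosetsOf p).card * (t * ((M - m) * Real.sqrt (k * t))) := by
  have hL : 0 ≤ M - m := sub_nonneg.2 hmM
  have hstep' : ∀ i I a, q (i + 1) I a = max (q i I a + G.instRegret p (σ i) I a) 0 :=
    fun i I a => by rw [hstep, rmPlusUpdate_eq]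
  have hq : ∀ i I a, 0 ≤ q i I a := fun i I a => by
    cases i with
    | zero => exact (hq0 I a).ge
    | succ i => exact (hstep' i I a).symm ▸ le_max_right _ _
  obtain ⟨c, hc, hc'⟩ := G.exists_reachOwn_eq hrecall hs
  have hI : ∀ I ∈ G.infosetsOf p, c I * ∑ a ∈ G.acts I, s I a *
      ∑ i ∈ Finset.range t, ((i : ℝ) + 1) * G.instRegret p (σ i) I a ≤
      t * ((M - m) * Real.sqrt (k * t)) := by
    intro I hI
    have hB : 0 ≤ t * ((M - m) * Real.sqrt (k * t)) := by positivity
    refine le_trans (mul_le_mul_of_nonneg_left ?_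
      (hc I hI).1) (mul_le_of_le_one_left hB (hc I hI).2)
    calc _ ≤ ∑ a ∈ G.acts I, s I a * (t * ((M - m) * Real.sqrt (k * t))) := by
          refine Finset.sum_le_sum fun a ha => mul_le_mul_of_nonneg_left ?_ ((hs I hI).1 a ha)
          refine (sum_weighted_regret_le (q := fun i => q i I a) (fun i => hq i I a)
            (fun i => (hstep' i I a).symm ▸ le_max_left _ _) t).trans ?_
          refine mul_le_mul_of_nonneg_left ?_ (Nat.cast_nonneg t)
          exact regretMatching_plus_le (G.acts I) (q := fun i => q i I)
            (r := fun i => G.instRegret p (σ i) I) (fun a _ => hq0 I a) (fun i a _ => hstep' i I a)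
            (fun i => G.sum_mul_instRegret (hσq i) (hq i) I) hL (hk I hI)
            (fun i a ha => G.abs_instRegret_le hrecall (hσ i) hu hI ha) t ha
      _ = _ := by rw [← Finset.sum_mul, (hs I hI).2, one_mul]
  calc _ = ∑ I ∈ G.infosetsOf p, c I * ∑ a ∈ G.acts I, s I a *
        ∑ i ∈ Finset.range t, ((i : ℝ) + 1) * G.instRegret p (σ i) I a := by
        simp only [G.utility_update_sub_eq p _ hs c hc', Finset.mul_sum]
        rw [Finset.sum_comm]
        refine Finset.sum_congr rfl fun I _ => ?_
        rw [Finset.sum_comm]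
        exact Finset.sum_congr rfl fun a _ => Finset.sum_congr rfl fun i _ => by ring
    _ ≤ ∑ _I ∈ G.infosetsOf p, t * ((M - m) * Real.sqrt (k * t)) := Finset.sum_le_sum hI
    _ = _ := by rw [Finset.sum_const, nsmul_eq_mul]

/-! ### Average strategies realize mixtures -/

section Average

variable {G} {p : Fin 2} {T : Finset ℕ} {w : ℕ → ℝ} {s : ℕ → ι → α → ℝ}

theorem reachInfo_nonneg {s : ι → α → ℝ} (hs : G.IsStrategy p s) (I : ι) :
    0 ≤ G.reachInfo p s I :=
  Finset.sum_nonneg fun _ hh => (G.reachOwn_mem_Icc hs (G.members_subset p I hh)).1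

theorem isStrategy_averageStrategy (hw : ∀ i ∈ T, 0 ≤ w i) (hw1 : ∑ i ∈ T, w i = 1)
    (hs : ∀ i, G.IsStrategy p (s i)) : G.IsStrategy p (G.averageStrategy p T w s) := by
  intro I hI
  have hwr : ∀ i ∈ T, 0 ≤ w i * G.reachInfo p (s i) I := fun i hi =>
    mul_nonneg (hw i hi) (reachInfo_nonneg (hs i) I)
  unfold averageStrategy
  split_ifs with h
  · refine ⟨fun a ha => Finset.sum_nonneg fun i hi => mul_nonneg (hw i hi) ((hs i I hI).1 a ha), ?_⟩
    rw [Finset.sum_comm, ← hw1]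
    exact Finset.sum_congr rfl fun i _ => by rw [← Finset.mul_sum, (hs i I hI).2, mul_one]
  · refine ⟨fun a ha => div_nonneg (Finset.sum_nonneg fun i hi =>
      mul_nonneg (hwr i hi) ((hs i I hI).1 a ha)) (Finset.sum_nonneg hwr), ?_⟩
    rw [← Finset.sum_div, Finset.sum_comm, div_eq_one_iff_eq h]
    exact Finset.sum_congr rfl fun i _ => by rw [← Finset.mul_sum, (hs i I hI).2, mul_one]

/-- The number of states is independent of the strategy, so it cancels in the quotient that defines
`averageStrategy`. -/
theorem reachInfo_eq (hrecall : G.PerfectRecall) (s : ι → α → ℝ) {h : List α}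
    (hh : h ∈ G.nodesOf p) : G.reachInfo p s (G.info h) =
      (G.members p (G.info h)).card * G.reachOwn p s h := by
  rw [reachInfo, ← nsmul_eq_mul, ← Finset.sum_const]
  refine Finset.sum_congr rfl fun j hj => ?_
  obtain ⟨h1, h2⟩ := G.mem_members.1 hj
  exact G.reachOwn_eq_of_info_eq hrecall s h1 hh h2

/-- The average strategy realizes the mixture. -/
theorem reachOwn_averageStrategy (hrecall : G.PerfectRecall) (hw : ∀ i ∈ T, 0 ≤ w i)
    (hw1 : ∑ i ∈ T, w i = 1) (hs : ∀ i, G.IsStrategy p (s i)) {h : List α} (hh : h ∈ G.H) :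
    G.reachOwn p (G.averageStrategy p T w s) h = ∑ i ∈ T, w i * G.reachOwn p (s i) h := by
  induction h with
  | nil => simp [reachOwn, hw1]
  | cons a h ih =>
    have hhH := G.parent_mem a h hh
    simp only [reachOwn]
    rw [ih hhH]
    by_cases hp : G.actor h = some p
    · have hn := G.mem_nodesOf_of_cons hh hp
      have hc : ((G.members p (G.info h)).card : ℝ) ≠ 0 := by
        exact_mod_cast Finset.card_ne_zero_of_mem (G.mem_members.2 ⟨hn, rfl⟩)
      simp only [hp, if_true, averageStrategy, reachInfo_eq hrecall _ hn]
      set N := ((G.members p (G.info h)).card : ℝ)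
      set m := ∑ i ∈ T, w i * G.reachOwn p (s i) h with hm
      have h1 : ∑ i ∈ T, w i * (N * G.reachOwn p (s i) h) = N * m := by
        rw [hm, Finset.mul_sum]
        exact Finset.sum_congr rfl fun i _ => by ring
      have h2 : ∑ i ∈ T, w i * (N * G.reachOwn p (s i) h) * s i (G.info h) a =
          N * ∑ i ∈ T, w i * (G.reachOwn p (s i) h * s i (G.info h) a) := by
        rw [Finset.mul_sum]
        exact Finset.sum_congr rfl fun i _ => by ring
      rw [h1, h2]
      by_cases hm0 : m = 0
      · rw [hm0, zero_mul]
        have h3 := (Finset.sum_eq_zero_iff_of_nonneg fun i hi =>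
          mul_nonneg (hw i hi) (G.reachOwn_mem_Icc (hs i) hhH).1).1 (hm.symm.trans hm0)
        exact (Finset.sum_eq_zero fun i hi => by rw [← mul_assoc, h3 i hi, zero_mul]).symm
      · rw [if_neg (mul_ne_zero hc hm0)]
        field_simp
    · simp [hp]

/-- With the other factors fixed, utility is linear in the own reach contributions, and these are
mixed exactly. -/
theorem utility_update_averageStrategy (hrecall : G.PerfectRecall) (hw : ∀ i ∈ T, 0 ≤ w i)
    (hw1 : ∑ i ∈ T, w i = 1) (hs : ∀ i, G.IsStrategy p (s i)) (r : Fin 2)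
    (σ : Fin 2 → ι → α → ℝ) :
    G.utility r (Function.update σ p (G.averageStrategy p T w s)) =
      ∑ i ∈ T, w i * G.utility r (Function.update σ p (s i)) := by
  simp only [utility, Finset.mul_sum]
  rw [Finset.sum_comm]
  refine Finset.sum_congr rfl fun z hz => ?_
  simp only [G.reach_eq_mul p, Function.update_self, reachOther_update]
  rw [reachOwn_averageStrategy hrecall hw hw1 hs (Finset.mem_filter.1 hz).1, Finset.sum_mul,
    Finset.sum_mul]
  exact Finset.sum_congr rfl fun i _ => by ring

end Average

/-! ### From regrets to exploitability -/

theorem utility_one_eq_neg (hzero : G.ZeroSum) (σ : Fin 2 → ι → α → ℝ) :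
    G.utility 1 σ = -G.utility 0 σ := by
  rw [utility, utility, ← Finset.sum_neg_distrib]
  refine Finset.sum_congr rfl fun z hz => ?_
  have := hzero z hz
  rw [Fin.sum_univ_two] at this
  rw [eq_neg_of_add_eq_zero_right this, mul_neg]

/-- Player 2's utilities fill the reflected interval, so the same range `l` serves both players. -/
theorem exists_utility_bounds (hzero : G.ZeroSum) {l : ℝ}
    (hl : IsGreatest {x : ℝ | ∃ y ∈ G.terminals, ∃ z ∈ G.terminals,
      x = G.u 0 y - G.u 0 z} l) (p : Fin 2) :
    ∃ m M, m ≤ M ∧ M - m = l ∧ ∀ z ∈ G.terminals, G.u p z ∈ Set.Icc m M := by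
  obtain ⟨⟨y, hy, z, hz, rfl⟩, hmax⟩ := hl
  have h0 : ∀ x ∈ G.terminals, G.u 0 x ∈ Set.Icc (G.u 0 z) (G.u 0 y) := fun x hx => by
    have h1 := hmax ⟨y, hy, x, hx, rfl⟩
    have h2 := hmax ⟨x, hx, z, hz, rfl⟩
    exact ⟨by linarith, by linarith⟩
  match p with
  | 0 => exact ⟨_, _, (h0 y hy).1, rfl, h0⟩
  | 1 =>
    refine ⟨-G.u 0 y, -G.u 0 z, neg_le_neg (h0 y hy).1, by ring, fun x hx => ?_⟩
    have := hzero x hx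
    rw [Fin.sum_univ_two] at this
    rw [eq_neg_of_add_eq_zero_right this]
    exact ⟨neg_le_neg (h0 x hx).2, neg_le_neg (h0 x hx).1⟩

theorem card_acts_le {p : Fin 2} {I : ι} (hI : I ∈ G.infosetsOf p) :
    ((G.acts I).card : ℝ) ≤ G.maxActions := by
  have : I ∈ G.infosets := by
    match p with
    | 0 => exact Finset.mem_union_left _ hI
    | 1 => exact Finset.mem_union_right _ hI
  exact_mod_cast Finset.le_sup (f := fun I => (G.acts I).card) this

theorem isStrategy_cfrPlus (p : Fin 2) (t : ℕ) : G.IsStrategy p (G.cfrPlus p t) :=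
  G.isStrategy_rmStrategy p _

theorem cfrPlusValues_nonneg (t : ℕ) (I : ι) (a : α) : 0 ≤ G.cfrPlusValues t 0 I a := by
  cases t with
  | zero => exact le_rfl
  | succ t =>
    rw [cfrPlusValues_succ_zero]
    exact le_max_right _ _

theorem update_pair_zero {κ β : Type*} (x y s : κ → β → ℝ) :
    Function.update ![x, y] 0 s = ![s, y] := by
  ext i : 1
  fin_cases i <;> simp

theorem update_pair_one {κ β : Type*} (x y s : κ → β → ℝ) :
    Function.update ![x, y] 1 s = ![x, s] := by
  ext i : 1
  fin_cases i <;> simp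

theorem sum_Icc_one_eq_sum_range (f : ℕ → ℝ) (t : ℕ) :
    ∑ i ∈ Finset.Icc 1 t, f i = ∑ i ∈ Finset.range t, f (i + 1) := by
  rw [Finset.range_eq_Ico, Finset.sum_Ico_add' f 0 t 1]
  rfl

theorem sum_linear_weights {t : ℕ} (ht : 1 ≤ t) :
    ∑ i ∈ Finset.range t, 2 / ((t : ℝ) ^ 2 + t) * ((i : ℝ) + 1) = 1 := by
  have h : ∀ n : ℕ, ∑ i ∈ Finset.range n, ((i : ℝ) + 1) = ((n : ℝ) ^ 2 + n) / 2 := fun n => by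
    induction n with
    | zero => simp
    | succ n ih =>
      rw [Finset.sum_range_succ, ih]
      push_cast
      ring
  have ht0 : (0 : ℝ) < t := by exact_mod_cast ht
  rw [← Finset.mul_sum, h]
  field_simp

/-- The best response values against the CFR⁺ average profile add up to at most the sum of the
linearly weighted regrets. -/
theorem exploitability_le (hzero : G.ZeroSum) (hrecall : G.PerfectRecall) {t : ℕ} (ht : 1 ≤ t)
    (B : Fin 2 → ℝ)
    (hB0 : ∀ s, G.IsStrategy 0 s → ∑ i ∈ Finset.range t, ((i : ℝ) + 1) *
      (G.utility 0 ![s, G.cfrPlus 1 i] - G.utility 0 ![G.cfrPlus 0 i, G.cfrPlus 1 i]) ≤ B 0)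
    (hB1 : ∀ s, G.IsStrategy 1 s → ∑ i ∈ Finset.range t, ((i : ℝ) + 1) *
      (G.utility 1 ![G.cfrPlus 0 (i + 1), s] -
        G.utility 1 ![G.cfrPlus 0 (i + 1), G.cfrPlus 1 i]) ≤ B 1) :
    G.exploitability (G.cfrPlusAverage t) ≤ 2 / ((t : ℝ) ^ 2 + t) * (B 0 + B 1) := by
  obtain ⟨s₀, hs₀, h₀⟩ := (G.bestResponse_isGreatest 0 (G.cfrPlusAverage t)).1
  obtain ⟨s₁, hs₁, h₁⟩ := (G.bestResponse_isGreatest 1 (G.cfrPlusAverage t)).1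
  have hc : 0 ≤ 2 / ((t : ℝ) ^ 2 + t) := by positivity
  have hx : ∑ i ∈ Finset.Icc 1 t, 2 / ((t : ℝ) ^ 2 + t) * (i : ℝ) = 1 := by
    rw [sum_Icc_one_eq_sum_range]
    exact_mod_cast sum_linear_weights ht
  have e₀ : G.bestResponse 0 (G.cfrPlusAverage t) = ∑ i ∈ Finset.range t,
      2 / ((t : ℝ) ^ 2 + t) * ((i : ℝ) + 1) * G.utility 0 ![s₀, G.cfrPlus 1 i] := by
    -- The average is viewed as an update of a pair whose second entry is a dummy, so that linearity
    -- applies to it.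
    rw [← h₀, cfrPlusAverage, update_pair_zero,
      ← update_pair_one s₀ s₀ (G.averageStrategy 1 _ _ _),
      utility_update_averageStrategy hrecall (fun i _ => by positivity) (sum_linear_weights ht)
        (G.isStrategy_cfrPlus 1)]
    simp only [update_pair_one]
  have e₁ : G.bestResponse 1 (G.cfrPlusAverage t) = ∑ i ∈ Finset.range t,
      2 / ((t : ℝ) ^ 2 + t) * ((i : ℝ) + 1) * G.utility 1 ![G.cfrPlus 0 (i + 1), s₁] := by
    rw [← h₁, cfrPlusAverage, update_pair_one,
      ← update_pair_zero s₁ s₁ (G.averageStrategy 0 _ _ _),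
      utility_update_averageStrategy hrecall (fun i _ => by positivity) hx
        (G.isStrategy_cfrPlus 0), sum_Icc_one_eq_sum_range]
    simp only [update_pair_zero, Nat.cast_add, Nat.cast_one]
  -- This absorbs the mismatch of the alternating updates: Player 1's regret refers to `σ₁ⁱ`, Player
  -- 2's to `σ₁ⁱ⁺¹`.
  have hmono : ∀ i, G.utility 0 ![G.cfrPlus 0 i, G.cfrPlus 1 i] ≤
      G.utility 0 ![G.cfrPlus 0 (i + 1), G.cfrPlus 1 i] := fun i => by
    have h := G.utility_le_utility_update hrecall (p := 0)
      (σ := ![G.cfrPlus 0 i, G.cfrPlus 1 i]) (q := G.cfrPlusValues i 0) rfl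
      (G.cfrPlusValues_nonneg i)
    rwa [← cfrPlusValues_succ_zero, update_pair_zero] at h
  rw [exploitability, Fin.sum_univ_two, e₀, e₁, G.utility_one_eq_neg hzero (G.cfrPlusAverage t)]
  simp only [mul_assoc, ← Finset.mul_sum]
  have hsum : ∑ i ∈ Finset.range t, ((i : ℝ) + 1) * G.utility 0 ![s₀, G.cfrPlus 1 i] +
      ∑ i ∈ Finset.range t, ((i : ℝ) + 1) * G.utility 1 ![G.cfrPlus 0 (i + 1), s₁] ≤
      B 0 + B 1 := by
    refine le_trans ?_ (add_le_add (hB0 s₀ hs₀) (hB1 s₁ hs₁))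
    rw [← Finset.sum_add_distrib, ← Finset.sum_add_distrib]
    refine Finset.sum_le_sum fun i _ => ?_
    rw [G.utility_one_eq_neg hzero ![G.cfrPlus 0 (i + 1), G.cfrPlus 1 i]]
    have := mul_le_mul_of_nonneg_left (hmono i) (by positivity : (0 : ℝ) ≤ (i : ℝ) + 1)
    linarith
  linarith [mul_le_mul_of_nonneg_left hsum hc]

end

end Game

end EFG

theorem theorem4 {α ι : Type*} [Fintype α] [DecidableEq α] [DecidableEq ι]
    (G : EFG.Game α ι) (hzero : G.ZeroSum) (hrecall : G.PerfectRecall)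
    (l : ℝ) (hl : IsGreatest {x : ℝ | ∃ y ∈ G.terminals, ∃ z ∈ G.terminals,
      x = G.u 0 y - G.u 0 z} l)
    (t : ℕ) (ht : 1 ≤ t) :
    (∀ p : Fin 2, G.IsStrategy p (G.cfrPlusAverage t p)) ∧
      G.exploitability (G.cfrPlusAverage t) ≤
        2 * (G.infosets.card : ℝ) * l * Real.sqrt ((G.maxActions : ℝ) / (t : ℝ)) := by
  have htR : (0 : ℝ) < t := by exact_mod_cast ht
  constructor
  · intro p
    match p with
    | 0 =>
      refine EFG.Game.isStrategy_averageStrategy (fun i _ => by positivity) ?_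
        (G.isStrategy_cfrPlus 0)
      rw [EFG.Game.sum_Icc_one_eq_sum_range]
      exact_mod_cast EFG.Game.sum_linear_weights ht
    | 1 =>
      exact EFG.Game.isStrategy_averageStrategy (fun i _ => by positivity)
        (EFG.Game.sum_linear_weights ht) (G.isStrategy_cfrPlus 1)
  · have hregret : ∀ p : Fin 2, ∀ σ : ℕ → Fin 2 → ι → α → ℝ, (∀ i r, G.IsStrategy r (σ i r)) →
        (∀ i, σ i p = G.cfrPlus p i) → (∀ i, G.cfrPlusValues (i + 1) p =
          G.rmPlusUpdate p (σ i) (G.cfrPlusValues i p)) → ∀ s, G.IsStrategy p s →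
        ∑ i ∈ Finset.range t, ((i : ℝ) + 1) *
          (G.utility p (Function.update (σ i) p s) - G.utility p (σ i)) ≤
        (G.infosetsOf p).card * (t * (l * Real.sqrt (G.maxActions * t))) := by
      intro p σ hσ hσp hstep s hs
      obtain ⟨m, M, hmM, rfl, hu⟩ := G.exists_utility_bounds hzero hl p
      exact G.sum_weighted_utility_sub_le hrecall (q := fun i => G.cfrPlusValues i p) hσ hσp
        (fun _ _ => rfl) hstep hmM hu (fun I hI => G.card_acts_le hI) hs t
    have hpair : ∀ i j r, G.IsStrategy r ((![G.cfrPlus 0 i, G.cfrPlus 1 j] :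
        Fin 2 → ι → α → ℝ) r) := fun i j r => by
      match r with
      | 0 => exact G.isStrategy_cfrPlus 0 i
      | 1 => exact G.isStrategy_cfrPlus 1 j
    have hbound := G.exploitability_le hzero hrecall ht
      (fun p => (G.infosetsOf p).card * (t * (l * Real.sqrt (G.maxActions * t))))
      (fun s hs => by
        simpa only [EFG.Game.update_pair_zero] using hregret 0
          (fun i => ![G.cfrPlus 0 i, G.cfrPlus 1 i]) (fun i => hpair i i) (fun _ => rfl)
          G.cfrPlusValues_succ_zero s hs)
      -- Player 2 responds to the already updated strategy of Player 1, hence the shifted index.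
      (fun s hs => by
        simpa only [EFG.Game.update_pair_one] using hregret 1
          (fun i => ![G.cfrPlus 0 (i + 1), G.cfrPlus 1 i]) (fun i => hpair (i + 1) i)
          (fun _ => rfl) G.cfrPlusValues_succ_one s hs)
    refine hbound.trans ?_
    have hl0 : 0 ≤ l := by
      obtain ⟨m, M, hmM, rfl, -⟩ := G.exists_utility_bounds hzero hl 0
      exact sub_nonneg.2 hmM
    have hcard : (G.infosets.card : ℝ) = (G.infosetsOf 0).card + (G.infosetsOf 1).card := by
      rw [EFG.Game.infosets, Finset.card_union_of_disjoint G.disjoint_infosetsOf, Nat.cast_add]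
    have hsqrt : Real.sqrt ((G.maxActions : ℝ) * t) = t * Real.sqrt ((G.maxActions : ℝ) / t) := by
      rw [show (G.maxActions : ℝ) * t = (t : ℝ) ^ 2 * (G.maxActions / t) by field_simp,
        Real.sqrt_mul (sq_nonneg _), Real.sqrt_sq htR.le]
    rw [hcard, hsqrt]
    set S := Real.sqrt ((G.maxActions : ℝ) / t)
    set N := ((G.infosetsOf 0).card : ℝ) + (G.infosetsOf 1).card with hN
    -- The weight `2 / (t² + t)` times `t · t √(k / t)` leaves the factor `t / (t + 1)`, which is
    -- dropped.
    calc _ = t / (t + 1) * (2 * N * l * S) := by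
          rw [hN]
          field_simp
      _ ≤ 2 * N * l * S := mul_le_of_le_one_left (by positivity)
          ((div_le_one (by positivity)).2 (by linarith))
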